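/- Let $\mathcal S$ be a finite set of users and, for each pair of distinct users $i,j$, let $\lambda^C_{i,j}=\lambda^C_{j,i}>0$ and $\lambda^I_{i,j}=\lambda^I_{j,i}>0$. Let $H_{i,j}(t)=H_{j,i}(t)\in\{0,1\}$, $t\ge 0$, be the contact process of the pair: an alternating process whose successive durations in state $1$ (in contact) are exponential with rate $\lambda^C_{i,j}$ and whose successive durations in state $0$ (not in contact) are exponential with rate $\lambda^I_{i,j}$, all durations being independent of each other and of the initial state $H_{i,j}(0)$, whose law is arbitrary. The processes of different pairs are independent. Let $x_{j,f}\in\{0,1\}$ indicate whether user $j$ caches file $f$, let $i\in\mathcal S$ and a file $f$ be such that $x_{i,f}=0$, and let $T^d>0$. Put $$H_i^f(t)=1-\prod_{j\in\mathcal S\setminus\{i\},\,x_{j,f}=1}\bigl(1-H_{i,j}(t)\bigr),\qquad W_{T}=\int_{T}^{T+T^d}H_i^f(t)\,dt .$$ Then $W_T$ converges in distribution as $T\to\infty$. Let the communication time $T^c_{i,f}$ be a random variable with the limit law. It is square integrable, with $$\mathbb E[T^c_{i,f}]=T^d\Bigl(1-\prod_{j\in\mathcal S,\,x_{j,f}=1}\frac{\lambda^C_{i,j}}{\lambda^C_{i,j}+\lambda^I_{i,j}}\Bigr)$$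 and $$\mathrm{Var}[T^c_{i,f}]=2\int_0^{T^d}(T^d-u)\prod_{j\in\mathcal S,\,x_{j,f}=1}\frac{\lambda^C_{i,j}\bigl[\lambda^C_{i,j}+\lambda^I_{i,j}e^{-u(\lambda^C_{i,j}+\lambda^I_{i,j})}\bigr]}{(\lambda^I_{i,j}+\lambda^C_{i,j})^2}\,du-(T^d)^2\prod_{j\in\mathcal S,\,x_{j,f}=1}\Bigl(\frac{\lambda^C_{i,j}}{\lambda^C_{i,j}+\lambda^I_{i,j}}\Bigr)^2 .$$ Moreover $\mathbb E[W_T]$ and $\mathrm{Var}[W_T]$ converge to these two values as $T\to\infty$. If the processes $H_{i,j}$, $j\ne i$, are stationary, that is, $\Pr[H_{i,j}(0)=1]=\lambda^I_{i,j}/(\lambda^C_{i,j}+\lambda^I_{i,j})$ for all $j\neq i$, then for every $T\ge 0$ the mean and variance of $W_T$ are equal to these two values. -/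

import Mathlib

open MeasureTheory ProbabilityTheory Filter Topology

noncomputable section

/-- Start of the `n`-th cycle (counted from `0`) of an alternating renewal path that starts in
state `b` at time `0`.  The number `d s k` is the duration of the `k`-th visit to state `s`; a
cycle is a visit to `b` followed by a visit to the other state. -/
def cycleStart (b : Bool) (d : Bool → ℕ → ℝ) (n : ℕ) : ℝ :=
  ∑ k ∈ Finset.range n, (d b k + d (!b) k)

/-- At time `t` the alternating path is in the first phase of a cycle, i.e. in its initial
state `b`. -/
def InFirstPhase (b : Bool) (d : Bool → ℕ → ℝ) (t : ℝ) : Prop :=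
  ∃ n : ℕ, cycleStart b d n ≤ t ∧ t < cycleStart b d n + d b n

/-- At time `t` the alternating path is in the second phase of a cycle, i.e. in the state
`!b`. -/
def InSecondPhase (b : Bool) (d : Bool → ℕ → ℝ) (t : ℝ) : Prop :=
  ∃ n : ℕ, cycleStart b d n + d b n ≤ t ∧ t < cycleStart b d (n + 1)

/-- The alternating path is in the state `true` ("in contact") at time `t`. -/
def InContact (b : Bool) (d : Bool → ℕ → ℝ) (t : ℝ) : Prop :=
  (b = true ∧ InFirstPhase b d t) ∨ (b = false ∧ InSecondPhase b d t)

open scoped Classical in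
/-- The `{0,1}`-valued contact process of a pair: `1` while in contact, `0` otherwise. -/
def contactProcess (b : Bool) (d : Bool → ℕ → ℝ) (t : ℝ) : ℝ :=
  if InContact b d t then 1 else 0

/-- The mobility model for the users `U`.  For a pair `e` of distinct users, `Z e` is the state at
time `0` (`true`: in contact), `D e true k` is the `k`-th contact duration and `D e false k` the
`k`-th inter-contact duration.  All durations are exponential, with rate `lamC e` for the contact
times and `lamI e` for the inter-contact times, and independent of each other and of the initial
state, whose law is arbitrary; the timelines of different pairs are independent. -/
structure IsMobilityModel {Ω U : Type*} [MeasurableSpace Ω] (P : Measure Ω)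
    (lamC lamI : Sym2 U → ℝ) (Z : Sym2 U → Ω → Bool) (D : Sym2 U → Bool → ℕ → Ω → ℝ) : Prop where
  lamC_pos : ∀ e : Sym2 U, ¬ e.IsDiag → 0 < lamC e
  lamI_pos : ∀ e : Sym2 U, ¬ e.IsDiag → 0 < lamI e
  measurable_init : ∀ e : Sym2 U, ¬ e.IsDiag → Measurable (Z e)
  measurable_dur : ∀ e : Sym2 U, ¬ e.IsDiag → ∀ s k, Measurable (D e s k)
  law_contact : ∀ e : Sym2 U, ¬ e.IsDiag → ∀ k, P.map (D e true k) = expMeasure (lamC e)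
  law_inter : ∀ e : Sym2 U, ¬ e.IsDiag → ∀ k, P.map (D e false k) = expMeasure (lamI e)
  indep_dur : ∀ e : Sym2 U, ¬ e.IsDiag → iIndepFun (fun (p : Bool × ℕ) ω => D e p.1 p.2 ω) P
  indep_init : ∀ e : Sym2 U, ¬ e.IsDiag →
    IndepFun (Z e) (fun ω (p : Bool × ℕ) => D e p.1 p.2 ω) P
  indep_pairs : iIndepFun (fun (e : {e : Sym2 U // ¬ e.IsDiag}) ω =>
    (Z e ω, fun (p : Bool × ℕ) => D e p.1 p.2 ω)) P

variable {Ω U F : Type*}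

/-- The process `H_{i,j}(t)`. -/
def pairProcess (Z : Sym2 U → Ω → Bool) (D : Sym2 U → Bool → ℕ → Ω → ℝ)
    (i j : U) (t : ℝ) (ω : Ω) : ℝ :=
  contactProcess (Z s(i, j) ω) (fun s k => D s(i, j) s k ω) t

/-- The process `H_i^f(t)`: it is `1` if user `i` is in contact at time `t` with at least one other
user that caches `f`, and `0` otherwise; `x j f` says whether user `j` caches file `f`. -/
def downloadProcess [Fintype U] [DecidableEq U] (Z : Sym2 U → Ω → Bool)
    (D : Sym2 U → Bool → ℕ → Ω → ℝ) (x : U → F → Bool) (i : U) (f : F) (t : ℝ) (ω : Ω) : ℝ :=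
  1 - ∏ j ∈ Finset.univ.filter (fun j => j ≠ i ∧ x j f = true), (1 - pairProcess Z D i j t ω)

/-- The time during the window `[Tr, Tr + Td]` in which user `i` can download file `f`. -/
def windowTime [Fintype U] [DecidableEq U] (Z : Sym2 U → Ω → Bool)
    (D : Sym2 U → Bool → ℕ → Ω → ℝ) (x : U → F → Bool) (i : U) (f : F) (Td Tr : ℝ) (ω : Ω) : ℝ :=
  ∫ t in Tr..(Tr + Td), downloadProcess Z D x i f t ω

/-- `Tc` is a communication time of user `i` for file `f`: it is the limit in distribution, as the
request time tends to infinity, of the download time in a window of length `Td` that starts at the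
request time. -/
def IsCommunicationTime [Fintype U] [DecidableEq U] [MeasurableSpace Ω]
    (P : Measure Ω) [IsProbabilityMeasure P] (Z : Sym2 U → Ω → Bool)
    (D : Sym2 U → Bool → ℕ → Ω → ℝ) (x : U → F → Bool) (i : U) (f : F) (Td : ℝ)
    {Ω' : Type*} [MeasurableSpace Ω'] (P' : Measure Ω') [IsProbabilityMeasure P']
    (Tc : Ω' → ℝ) : Prop :=
  TendstoInDistribution (fun Tr : ℝ => windowTime Z D x i f Td Tr) atTop Tc (fun _ => P) P'

/-- The claimed mean of the communication time. -/
def commMean [Fintype U] (lamC lamI : Sym2 U → ℝ) (x : U → F → Bool) (i : U) (f : F)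
    (Td : ℝ) : ℝ :=
  Td * (1 - ∏ j ∈ Finset.univ.filter (fun j => x j f = true),
    lamC s(i, j) / (lamC s(i, j) + lamI s(i, j)))

/-- The claimed variance of the communication time. -/
def commVar [Fintype U] (lamC lamI : Sym2 U → ℝ) (x : U → F → Bool) (i : U) (f : F)
    (Td : ℝ) : ℝ :=
  2 * (∫ u in (0 : ℝ)..Td, (Td - u) * ∏ j ∈ Finset.univ.filter (fun j => x j f = true),
      (lamC s(i, j) / (lamI s(i, j) + lamC s(i, j)) ^ 2 *
        (lamC s(i, j) +
          lamI s(i, j) * Real.exp (-u * (lamC s(i, j) + lamI s(i, j))))))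
    - Td ^ 2 * ∏ j ∈ Finset.univ.filter (fun j => x j f = true),
      (lamC s(i, j) / (lamC s(i, j) + lamI s(i, j))) ^ 2

end

/-!
The window time is `Td - V`, where `V` is the time in the window during which `i` meets no other
user that caches `f`.  By Fubini and the independence of the pairs, the `k`-th moment of `V` is the
integral over the cube `[0, Td] ^ k` of a product over the pairs of the probabilities that a pair is
out of contact at `k` given times (`integral_idleTime_pow`).

For one pair, these probabilities are found from a renewal equation.  Let `K` be a bounded
observable of the path after time `t`.  Conditioning on the end of the first visit, the lack of
memory of the exponential law shows that the expectation `F b t` of `K`, for a path started in the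
state `b`, satisfies
`F b t = exp (-r_b t) F b 0 + ∫₀ᵗ r_b exp (-r_b s) F (!b) (t - s) ds`.
On bounded time intervals the integral operator is a contraction, so the only bounded solution is
the explicit one, `F b t = m + (F b 0 - m) exp (-(r true + r false) t)`, with `m` the mean of `F · 0`
under the stationary law of the two-state chain (`integral_durationLaw_eq`).  This replaces the
construction of the path as a Markov chain.  It gives the one- and two-point probabilities, the
exponential convergence of the `k`-point probabilities to their stationary values, and their
invariance in the stationary case.

Hence all moments of `V` converge to those of its stationary version, which lives on a product space
of durations and independent stationary initial states.  As `V` takes values in `[0, Td]`,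
convergence of moments is convergence in distribution
(`tendstoInDistribution_of_tendsto_moments`), and the limit law inherits the stationary mean and
variance.  The variance formula comes from
`∫₀ᵃ∫₀ᵃ g |s - t| dt ds = 2 ∫₀ᵃ (a - v) g v dv` (`integral_integral_abs_sub`).
-/

/-! ### Alternating paths with a new first visit -/

/-- The array of durations obtained from `d` by inserting a visit of length `s` to the state `b`
in front of all visits to `b`. -/
def prependVisit (b : Bool) (s : ℝ) (d : Bool × ℕ → ℝ) : Bool × ℕ → ℝ :=
  fun p => if p.1 = b then Nat.casesOn p.2 s (fun k => d (b, k)) else d p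

@[simp] lemma prependVisit_zero (b : Bool) (s : ℝ) (d : Bool × ℕ → ℝ) :
    prependVisit b s d (b, 0) = s := by simp [prependVisit]

@[simp] lemma prependVisit_succ (b : Bool) (s : ℝ) (d : Bool × ℕ → ℝ) (k : ℕ) :
    prependVisit b s d (b, k + 1) = d (b, k) := by simp [prependVisit]

@[simp] lemma prependVisit_not (b : Bool) (s : ℝ) (d : Bool × ℕ → ℝ) (k : ℕ) :
    prependVisit b s d (!b, k) = d (!b, k) := by simp [prependVisit]

lemma cycleStart_succ (b : Bool) (d : Bool → ℕ → ℝ) (n : ℕ) :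
    cycleStart b d (n + 1) = cycleStart b d n + (d b n + d (!b) n) :=
  Finset.sum_range_succ _ _

lemma cycleStart_nonneg (b : Bool) {d : Bool → ℕ → ℝ} (hd : ∀ s k, 0 ≤ d s k) (n : ℕ) :
    0 ≤ cycleStart b d n :=
  Finset.sum_nonneg fun k _ => add_nonneg (hd b k) (hd _ k)

lemma cycleStart_prependVisit (b : Bool) (s : ℝ) (d : Bool × ℕ → ℝ) (n : ℕ) :
    cycleStart b (Function.curry (prependVisit b s d)) n + prependVisit b s d (b, n) =
      s + cycleStart (!b) (Function.curry d) n := by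
  induction n with
  | zero => simp [cycleStart]
  | succ n ih =>
    rw [cycleStart_succ, cycleStart_succ]
    simp only [Function.curry_apply, prependVisit_succ, prependVisit_not, Bool.not_not]
    linarith

lemma inSecondPhase_prependVisit (b : Bool) (s : ℝ) (d : Bool × ℕ → ℝ) (t : ℝ) :
    InSecondPhase b (Function.curry (prependVisit b s d)) t ↔
      InFirstPhase (!b) (Function.curry d) (t - s) := by
  refine exists_congr fun n => ?_
  have h := cycleStart_prependVisit b s d n
  rw [cycleStart_succ]
  simp only [Function.curry_apply, prependVisit_not]
  constructor <;> rintro ⟨h1, h2⟩ <;> constructor <;> linarith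

lemma inFirstPhase_prependVisit (b : Bool) (s : ℝ) (d : Bool × ℕ → ℝ) (t : ℝ) :
    InFirstPhase b (Function.curry (prependVisit b s d)) t ↔
      (0 ≤ t ∧ t < s) ∨ InSecondPhase (!b) (Function.curry d) (t - s) := by
  unfold InFirstPhase InSecondPhase
  rw [← Nat.or_exists_add_one]
  refine or_congr (by simp [cycleStart]) (exists_congr fun n => ?_)
  have h := cycleStart_prependVisit b s d n
  rw [cycleStart_succ, cycleStart_succ]
  simp only [Function.curry_apply, prependVisit_not, prependVisit_succ, Bool.not_not]
  constructor <;> rintro ⟨h1, h2⟩ <;> constructor <;> linarith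

/-- The path stays in its initial state `b` during the prepended visit and afterwards follows the
remaining path, which starts in the other state. -/
lemma inContact_prependVisit (b : Bool) {s t : ℝ} {d : Bool × ℕ → ℝ} (hd : ∀ p, 0 ≤ d p)
    (ht : 0 ≤ t) :
    InContact b (Function.curry (prependVisit b s d)) t ↔
      if t < s then b = true else InContact (!b) (Function.curry d) (t - s) := by
  have hd' : ∀ s k, 0 ≤ Function.curry d s k := fun s k => hd (s, k)
  have h1 : t < s → ¬ InFirstPhase (!b) (Function.curry d) (t - s) := by
    rintro h ⟨n, hn, -⟩
    linarith [cycleStart_nonneg (!b) hd' n]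
  unfold InContact
  rw [inSecondPhase_prependVisit, inFirstPhase_prependVisit]
  cases b <;> by_cases h : t < s <;> simp_all

/-- The indicator of "not in contact at time `t`" for the path with initial state `y.1` and
durations `y.2`. -/
noncomputable def idle (y : Bool × (Bool × ℕ → ℝ)) (t : ℝ) : ℝ :=
  1 - contactProcess y.1 (Function.curry y.2) t

lemma idle_nonneg (y : Bool × (Bool × ℕ → ℝ)) (t : ℝ) : 0 ≤ idle y t := by
  unfold idle contactProcess; split_ifs <;> norm_num

lemma idle_le_one (y : Bool × (Bool × ℕ → ℝ)) (t : ℝ) : idle y t ≤ 1 := by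
  unfold idle contactProcess; split_ifs <;> norm_num

lemma idle_prependVisit (b : Bool) {s t : ℝ} {d : Bool × ℕ → ℝ} (hd : ∀ p, 0 ≤ d p)
    (ht : 0 ≤ t) :
    idle (b, prependVisit b s d) t =
      if t < s then (if b = true then 0 else 1) else idle (!b, d) (t - s) := by
  classical
  have hc := inContact_prependVisit b (s := s) hd ht
  by_cases h : t < s
  · rw [if_pos h] at hc ⊢
    unfold idle contactProcess
    rw [if_congr hc rfl rfl]
    split_ifs <;> simp
  · rw [if_neg h] at hc ⊢
    unfold idle contactProcess
    rw [if_congr hc rfl rfl]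

lemma measurable_cycleStart (b : Bool) (n : ℕ) :
    Measurable (fun d : Bool × ℕ → ℝ => cycleStart b (Function.curry d) n) := by
  unfold cycleStart Function.curry
  fun_prop

lemma measurable_idle :
    Measurable (fun q : (Bool × (Bool × ℕ → ℝ)) × ℝ => idle q.1 q.2) := by
  have hfirst (b : Bool) : MeasurableSet
      {q : (Bool × (Bool × ℕ → ℝ)) × ℝ | InFirstPhase b (Function.curry q.1.2) q.2} := by
    have h (n : ℕ) : Measurable (fun q : (Bool × (Bool × ℕ → ℝ)) × ℝ =>
      cycleStart b (Function.curry q.1.2) n) := (measurable_cycleStart b n).comp (by fun_prop)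
    simp only [InFirstPhase, Set.ofPred_exists, Set.ofPred_and, Function.curry_apply]
    exact .iUnion fun n => (measurableSet_le (h n) (by fun_prop)).inter
      (measurableSet_lt (by fun_prop) ((h n).add (by fun_prop)))
  have hsecond (b : Bool) : MeasurableSet
      {q : (Bool × (Bool × ℕ → ℝ)) × ℝ | InSecondPhase b (Function.curry q.1.2) q.2} := by
    have h (n : ℕ) : Measurable (fun q : (Bool × (Bool × ℕ → ℝ)) × ℝ =>
      cycleStart b (Function.curry q.1.2) n) := (measurable_cycleStart b n).comp (by fun_prop)
    simp only [InSecondPhase, Set.ofPred_exists, Set.ofPred_and, Function.curry_apply]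
    exact .iUnion fun n => (measurableSet_le ((h n).add (by fun_prop)) (by fun_prop)).inter
      (measurableSet_lt (by fun_prop) (h (n + 1)))
  have hb (b : Bool) : MeasurableSet {q : (Bool × (Bool × ℕ → ℝ)) × ℝ | q.1.1 = b} :=
    measurableSet_eq_fun (by fun_prop) (by fun_prop)
  have hcontact : MeasurableSet
      {q : (Bool × (Bool × ℕ → ℝ)) × ℝ | InContact q.1.1 (Function.curry q.1.2) q.2} := by
    have : {q : (Bool × (Bool × ℕ → ℝ)) × ℝ | InContact q.1.1 (Function.curry q.1.2) q.2} =
        ({q | q.1.1 = true} ∩ {q | InFirstPhase true (Function.curry q.1.2) q.2}) ∪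
        ({q | q.1.1 = false} ∩ {q | InSecondPhase false (Function.curry q.1.2) q.2}) := by
      ext ⟨⟨b, d⟩, t⟩
      cases b <;> simp [InContact]
    rw [this]
    exact ((hb _).inter (hfirst _)).union ((hb _).inter (hsecond _))
  unfold idle contactProcess
  exact measurable_const.sub (Measurable.ite hcontact measurable_const measurable_const)

/-! ### The law of the durations -/

/-- The law of an array of independent durations, those of the visits to the state `s` being
exponential with rate `r s`. -/
noncomputable def durationLaw (r : Bool → ℝ) : Measure (Bool × ℕ → ℝ) :=
  Measure.infinitePi fun p => expMeasure (r p.1)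

lemma isProbabilityMeasure_durationLaw {r : Bool → ℝ} (hr : ∀ b, 0 < r b) :
    IsProbabilityMeasure (durationLaw r) := by
  have := fun b => isProbabilityMeasure_expMeasure (hr b)
  unfold durationLaw; infer_instance

lemma measurable_prependVisit (b : Bool) :
    Measurable (fun q : ℝ × (Bool × ℕ → ℝ) => prependVisit b q.1 q.2) := by
  refine measurable_pi_lambda _ fun ⟨c, n⟩ => ?_
  unfold prependVisit
  by_cases h : c = b
  · cases n <;> simp only [h, if_true] <;> fun_prop
  · simp only [h, if_false]; fun_prop

/-- The first visit to `b` is independent of the remaining durations, which again have the law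
`durationLaw r`. -/
lemma map_prependVisit {r : Bool → ℝ} (hr : ∀ b, 0 < r b) (b : Bool) :
    ((expMeasure (r b)).prod (durationLaw r)).map (fun q => prependVisit b q.1 q.2) =
      durationLaw r := by
  classical
  have := fun b => isProbabilityMeasure_expMeasure (hr b)
  have := isProbabilityMeasure_durationLaw hr
  refine Measure.eq_infinitePi _ fun S t ht => ?_
  rw [Measure.map_apply (measurable_prependVisit b) (.pi S.countable_toSet fun _ _ => ht _)]
  -- the position in the new array of each entry of `d`; only `(b, 0)` is not in the range of `σ`
  let σ : Bool × ℕ → Bool × ℕ := fun p => if p.1 = b then (b, p.2 + 1) else p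
  have hσ : σ.Injective := by
    rintro ⟨c, n⟩ ⟨c', n'⟩ h
    simp only [σ] at h
    split_ifs at h <;> simp_all
  have hrange (p : Bool × ℕ) : p ∈ Set.range σ ↔ p ≠ (b, 0) := by
    rcases p with ⟨c, n⟩
    constructor
    · rintro ⟨⟨c', n'⟩, h⟩ h'
      rw [h'] at h
      simp only [σ] at h
      split_ifs at h <;> simp_all
    · intro h
      by_cases hc : c = b
      · subst hc
        cases n with
        | zero => simp at h
        | succ n => exact ⟨(c, n), by simp [σ]⟩
      · exact ⟨(c, n), by simp [σ, hc]⟩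
  have hσr (p : Bool × ℕ) : (σ p).1 = p.1 := by
    simp only [σ]; split_ifs with h <;> simp [h]
  have happ (s : ℝ) (d : Bool × ℕ → ℝ) (p : Bool × ℕ) : prependVisit b s d (σ p) = d p := by
    rcases p with ⟨c, n⟩
    by_cases hc : c = b
    · subst hc; simp [σ]
    · simp [σ, hc, prependVisit]
  have hpre : (fun q : ℝ × (Bool × ℕ → ℝ) => prependVisit b q.1 q.2) ⁻¹' (S : Set _).pi t =
      {s | (b, 0) ∈ S → s ∈ t (b, 0)} ×ˢ
        ((S.preimage σ hσ.injOn : Finset _) : Set (Bool × ℕ)).pi (fun p => t (σ p)) := by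
    ext ⟨s, d⟩
    simp only [Set.mem_preimage, Set.mem_pi, Set.mem_prod, Finset.coe_preimage, Finset.mem_coe,
      Set.mem_ofPred_eq]
    constructor
    · intro h
      exact ⟨fun h0 => by simpa using h _ h0, fun p hp => by simpa [happ] using h _ hp⟩
    · rintro ⟨h0, h1⟩ p hp
      by_cases h : p = (b, 0)
      · subst h; simpa using h0 hp
      · obtain ⟨p, rfl⟩ := (hrange p).2 h
        simpa [happ] using h1 p hp
  rw [hpre, Measure.prod_prod, durationLaw, Measure.infinitePi_pi _ fun p _ => ht (σ p),
    ← Finset.prod_filter_mul_prod_filter_not S (fun p => p = (b, 0)), Finset.filter_eq']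
  congr 1
  · split_ifs with h
    · simp [h]
    · simp [h]
  · have := Finset.prod_preimage' σ S hσ.injOn (fun p => expMeasure (r p.1) (t p))
    simp only [hσr] at this
    rw [this]
    refine Finset.prod_congr (Finset.filter_congr fun p _ => ?_) fun _ _ => rfl
    rw [hrange]

lemma ae_expMeasure_pos {r : ℝ} (hr : 0 < r) : ∀ᵐ s ∂expMeasure r, 0 < s := by
  have := isProbabilityMeasure_expMeasure hr
  have h := cdf_expMeasure_eq hr 0
  rw [cdf_eq_real] at h
  simp only [le_refl, if_true, mul_zero, neg_zero, Real.exp_zero, sub_self] at h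
  rw [measureReal_eq_zero_iff] at h
  filter_upwards [measure_eq_zero_iff_ae_notMem.1 h] with s hs
  simpa using hs

lemma ae_durationLaw_pos {r : Bool → ℝ} (hr : ∀ b, 0 < r b) :
    ∀ᵐ d ∂durationLaw r, ∀ p, 0 < d p := by
  have := fun b => isProbabilityMeasure_expMeasure (hr b)
  rw [ae_all_iff]
  intro p
  exact (measurePreserving_eval_infinitePi (fun p : Bool × ℕ => expMeasure (r p.1))
    p).quasiMeasurePreserving.ae (ae_expMeasure_pos (hr p.1))

lemma integral_expMeasure {r : ℝ} (hr : 0 < r) (f : ℝ → ℝ) :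
    ∫ s, f s ∂expMeasure r = ∫ s in Set.Ioi 0, r * Real.exp (-(r * s)) * f s := by
  have hm : Measurable (gammaPDF 1 r) := (measurable_gammaPDFReal 1 r).ennreal_ofReal
  rw [expMeasure, gammaMeasure, integral_withDensity_eq_integral_toReal_smul hm
    (ae_of_all _ fun s => ENNReal.ofReal_lt_top), ← integral_indicator measurableSet_Ioi]
  refine integral_congr_ae ?_
  filter_upwards [Measure.ae_ne volume (0 : ℝ)] with s hs
  change (exponentialPDF r s).toReal • f s = _
  rw [exponentialPDF_eq, ENNReal.toReal_ofReal (by split_ifs <;> positivity), smul_eq_mul]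
  rcases lt_or_gt_of_ne hs with h | h
  · simp [h.not_ge, h.le]
  · simp [h.le, h]

/-! ### The renewal equation -/

/-- The absence of memory of the exponential law, in integrated form. -/
lemma integral_expMeasure_split {r : ℝ} (hr : 0 < r) {t : ℝ} (ht : 0 ≤ t) {φ ψ : ℝ → ℝ} {C : ℝ}
    (hφ : Measurable φ) (hψ : Measurable ψ) (hφC : ∀ s, |φ s| ≤ C) (hψC : ∀ s, |ψ s| ≤ C) :
    ∫ s, (if t < s then φ (s - t) else ψ s) ∂expMeasure r =
      Real.exp (-(r * t)) * (∫ s, φ s ∂expMeasure r) +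
        ∫ s in (0 : ℝ)..t, r * Real.exp (-(r * s)) * ψ s := by
  have hint {f : ℝ → ℝ} (hf : Measurable f) (hfC : ∀ s, |f s| ≤ C) :
      IntegrableOn (fun s => r * Real.exp (-(r * s)) * f s) (Set.Ioi 0) := by
    have h1 : IntegrableOn (fun s => r * Real.exp (-(r * s))) (Set.Ioi 0) := by
      have h := (exp_neg_integrableOn_Ioi 0 hr).const_mul r
      simp only [neg_mul] at h
      exact h
    exact h1.mul_bdd hf.aestronglyMeasurable (ae_of_all _ fun s => by simpa using hfC s)
  have hm : Measurable fun s => if t < s then φ (s - t) else ψ s :=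
    Measurable.ite measurableSet_Ioi (hφ.comp (by fun_prop)) hψ
  have hI := hint hm fun s => by split_ifs <;> simp [hφC, hψC]
  rw [integral_expMeasure hr, integral_expMeasure hr, ← Set.Ioc_union_Ioi_eq_Ioi ht,
    setIntegral_union (Set.Ioc_disjoint_Ioi le_rfl) measurableSet_Ioi
      (hI.mono_set Set.Ioc_subset_Ioi_self) (hI.mono_set (Set.Ioi_subset_Ioi ht)), add_comm]
  congr 1
  · rw [Set.Ioc_union_Ioi_eq_Ioi ht, ← integral_const_mul, ← integral_indicator measurableSet_Ioi,
      ← integral_indicator measurableSet_Ioi,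
      ← integral_sub_right_eq_self ((Set.Ioi 0).indicator _) t]
    congr 1 with s
    by_cases h : t < s
    · have h' : 0 < s - t := sub_pos.2 h
      have he : Real.exp (-(r * s)) = Real.exp (-(r * t)) * Real.exp (-(r * (s - t))) := by
        rw [← Real.exp_add]; ring_nf
      simp only [Set.indicator, Set.mem_Ioi, h, h', if_true]
      rw [he]; ring
    · have h' : ¬ 0 < s - t := by linarith
      simp [Set.indicator, h, h']
  · rw [intervalIntegral.integral_of_le ht]
    refine setIntegral_congr_fun measurableSet_Ioc fun s hs => ?_
    simp [hs.2.not_gt]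

lemma integral_exp_neg (r t : ℝ) :
    ∫ s in (0 : ℝ)..t, r * Real.exp (-(r * s)) = 1 - Real.exp (-(r * t)) := by
  rw [intervalIntegral.integral_eq_sub_of_hasDerivAt
    (fun s _ => hasDerivAt_neg_exp_mul_exp) (by apply Continuous.intervalIntegrable; fun_prop)]
  simp; ring

/-- The homogeneous renewal equation has no bounded solution but zero: on `[0, T]` its right-hand
side is a contraction, with factor the probability that a visit is shorter than `T`. -/
lemma eq_zero_of_renewal {r : Bool → ℝ} (hr : ∀ b, 0 < r b) {E : Bool → ℝ → ℝ} {C : ℝ}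
    (hC : ∀ b t, |E b t| ≤ C)
    (hE : ∀ b t, 0 ≤ t →
      E b t = ∫ s in (0 : ℝ)..t, r b * Real.exp (-(r b * s)) * E (!b) (t - s))
    (b : Bool) {T : ℝ} (hT : 0 ≤ T) : E b T = 0 := by
  set ρ : ℝ := 1 - Real.exp (-((r true + r false) * T)) with hρ
  have hR : ∀ b, r b ≤ r true + r false := by
    intro b; cases b <;> linarith [hr true, hr false]
  have hρ0 : 0 ≤ ρ := by
    have : 0 ≤ (r true + r false) * T := mul_nonneg (by linarith [hr true, hr false]) hT
    have := Real.exp_le_one_iff.2 (neg_nonpos.2 this)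
    linarith
  have hρ1 : ρ < 1 := by linarith [Real.exp_pos (-((r true + r false) * T))]
  have key : ∀ n : ℕ, ∀ b t, 0 ≤ t → t ≤ T → |E b t| ≤ ρ ^ n * C := by
    intro n
    induction n with
    | zero => intro b t _ _; simpa using hC b t
    | succ n ih =>
      intro b t ht htT
      have h0 : 0 ≤ ρ ^ n * C := (abs_nonneg _).trans (ih b t ht htT)
      rw [hE b t ht, ← Real.norm_eq_abs]
      calc ‖∫ s in (0 : ℝ)..t, r b * Real.exp (-(r b * s)) * E (!b) (t - s)‖
          ≤ ∫ s in (0 : ℝ)..t, r b * Real.exp (-(r b * s)) * (ρ ^ n * C) := by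
            refine intervalIntegral.norm_integral_le_of_norm_le ht (ae_of_all _ fun s hs => ?_)
              (by apply Continuous.intervalIntegrable; fun_prop)
            have h1 : 0 ≤ r b * Real.exp (-(r b * s)) := mul_nonneg (hr b).le (Real.exp_nonneg _)
            rw [norm_mul, Real.norm_of_nonneg h1]
            exact mul_le_mul_of_nonneg_left
              (ih _ _ (by linarith [hs.2]) (by linarith [hs.1])) h1
        _ = (1 - Real.exp (-(r b * t))) * (ρ ^ n * C) := by
            rw [intervalIntegral.integral_mul_const, integral_exp_neg]
        _ ≤ ρ * (ρ ^ n * C) := by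
            refine mul_le_mul_of_nonneg_right ?_ h0
            have : r b * t ≤ (r true + r false) * T :=
              mul_le_mul (hR b) htT ht (by linarith [hr true, hr false])
            have := Real.exp_le_exp.2 (neg_le_neg this)
            linarith
        _ = ρ ^ (n + 1) * C := by ring
  have hlim : Tendsto (fun n : ℕ => ρ ^ n * C) atTop (𝓝 0) := by
    simpa using (tendsto_pow_atTop_nhds_zero_of_lt_one hρ0 hρ1).mul_const C
  exact abs_nonpos_iff.1 (ge_of_tendsto' hlim fun n => key n b T hT le_rfl)

/-- The mean of `c : Bool → ℝ` under the stationary law of the two-state chain that leaves the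
state `s` at rate `r s`. -/
noncomputable def stationaryMean (r c : Bool → ℝ) : ℝ :=
  (r false * c true + r true * c false) / (r true + r false)

/-- The bounded solution of the renewal equation: exponential relaxation to the stationary mean
at rate `r true + r false`. -/
lemma eq_of_renewal {r : Bool → ℝ} (hr : ∀ b, 0 < r b) {F : Bool → ℝ → ℝ} {C : ℝ}
    (hFm : ∀ b, Measurable (F b)) (hC : ∀ b t, |F b t| ≤ C)
    (hF : ∀ b t, 0 ≤ t → F b t = Real.exp (-(r b * t)) * F b 0 +
      ∫ s in (0 : ℝ)..t, r b * Real.exp (-(r b * s)) * F (!b) (t - s))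
    (b : Bool) {T : ℝ} (hT : 0 ≤ T) :
    F b T = stationaryMean r (F · 0) +
      (F b 0 - stationaryMean r (F · 0)) * Real.exp (-((r true + r false) * T)) := by
  set m := stationaryMean r (F · 0) with hm
  set κ := r true + r false with hκ
  have hκ0 : 0 < κ := add_pos (hr true) (hr false)
  have hκb (b : Bool) : κ = r b + r (!b) := by cases b <;> simp [hκ, add_comm]
  have hmb (b : Bool) : F b 0 - m = r b / κ * (F b 0 - F (!b) 0) := by
    rw [hm, stationaryMean, ← hκ, eq_comm, ← sub_eq_zero]
    field_simp
    cases b <;> simp [hκ] <;> ring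
  -- the explicit function solves the same equation
  have hG (b : Bool) (t : ℝ) :
      ∫ s in (0 : ℝ)..t, r b * Real.exp (-(r b * s)) *
        (m + (F (!b) 0 - m) * Real.exp (-(κ * (t - s)))) =
      m + (F b 0 - m) * Real.exp (-(κ * t)) - Real.exp (-(r b * t)) * F b 0 := by
    have hr' := hr (!b)
    have hd : ∀ s ∈ Set.uIcc 0 t, HasDerivAt (fun s => -m * Real.exp (-(r b * s)) +
        (F (!b) 0 - m) * (r b / r (!b)) * Real.exp (-(κ * t) + r (!b) * s))
        (r b * Real.exp (-(r b * s)) *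
          (m + (F (!b) 0 - m) * Real.exp (-(κ * (t - s))))) s := by
      intro s _
      have h1 : HasDerivAt (fun s : ℝ => -(r b * s)) (-(r b)) s := by
        simpa only [mul_one] using ((hasDerivAt_id' s).const_mul (r b)).fun_neg
      have h2 : HasDerivAt (fun s : ℝ => -(κ * t) + r (!b) * s) (r (!b)) s := by
        simpa only [mul_one] using ((hasDerivAt_id' s).const_mul (r (!b))).const_add (-(κ * t))
      convert! (h1.exp.const_mul (-m)).add
        (h2.exp.const_mul ((F (!b) 0 - m) * (r b / r (!b)))) using 1
      have he : Real.exp (-(κ * t) + r (!b) * s) =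
          Real.exp (-(r b * s)) * Real.exp (-(κ * (t - s))) := by
        rw [← Real.exp_add, hκb b]; ring_nf
      rw [he]
      field_simp
    rw [intervalIntegral.integral_eq_sub_of_hasDerivAt hd
      (by apply Continuous.intervalIntegrable; fun_prop)]
    have he : Real.exp (-(κ * t) + r (!b) * t) = Real.exp (-(r b * t)) := by
      rw [hκb b]; ring_nf
    have h3 : (F (!b) 0 - m) * (r b / r (!b)) = -(F b 0 - m) := by
      rw [hmb b, hmb (!b), Bool.not_not]; field_simp; ring
    rw [he, h3]
    simp
    ring
  have hK (t : ℝ) (ht : 0 ≤ t) : |Real.exp (-(κ * t))| ≤ 1 := by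
    rw [abs_of_pos (Real.exp_pos _), Real.exp_le_one_iff]
    exact neg_nonpos.2 (mul_nonneg hκ0.le ht)
  -- the difference, cut off at negative times to keep it bounded
  let E : Bool → ℝ → ℝ := fun b t =>
    if 0 ≤ t then F b t - (m + (F b 0 - m) * Real.exp (-(κ * t))) else 0
  have hEC : ∀ b t, |E b t| ≤ C + (|m| + (C + |m|)) := by
    intro b t
    have hC0 : 0 ≤ C := (abs_nonneg _).trans (hC b t)
    by_cases h : 0 ≤ t
    · simp only [E, h, if_true]
      refine (abs_sub _ _).trans (add_le_add (hC b t) ((abs_add_le _ _).trans ?_))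
      rw [abs_mul]
      have h1 : |F b 0 - m| ≤ C + |m| := (abs_sub _ _).trans (by linarith [hC b 0])
      have := mul_le_mul h1 (hK t h) (abs_nonneg _) (by positivity)
      linarith
    · simp only [E, h, if_false, abs_zero]; positivity
  have hEeq : ∀ b t, 0 ≤ t →
      E b t = ∫ s in (0 : ℝ)..t, r b * Real.exp (-(r b * s)) * E (!b) (t - s) := by
    intro b t ht
    have hi : IntervalIntegrable (fun s => r b * Real.exp (-(r b * s)) * F (!b) (t - s))
        volume 0 t := by
      have h1 : IntervalIntegrable (fun s => r b * Real.exp (-(r b * s))) volume 0 t := by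
        apply Continuous.intervalIntegrable; fun_prop
      rw [intervalIntegrable_iff] at h1 ⊢
      exact h1.mul_bdd ((hFm _).comp (by fun_prop)).aestronglyMeasurable
        (ae_of_all _ fun s => by simpa using hC (!b) (t - s))
    have hcongr : ∫ s in (0 : ℝ)..t, r b * Real.exp (-(r b * s)) * E (!b) (t - s) =
        ∫ s in (0 : ℝ)..t, (r b * Real.exp (-(r b * s)) * F (!b) (t - s) -
          r b * Real.exp (-(r b * s)) * (m + (F (!b) 0 - m) * Real.exp (-(κ * (t - s))))) := by
      refine intervalIntegral.integral_congr fun s hs => ?_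
      rw [Set.uIcc_of_le ht] at hs
      have : 0 ≤ t - s := sub_nonneg.2 hs.2
      simp only [E, this, if_true]
      ring
    rw [hcongr, intervalIntegral.integral_sub hi
      (by apply Continuous.intervalIntegrable; fun_prop), hG]
    simp only [E, ht, if_true]
    rw [hF b t ht]
    ring
  have := eq_zero_of_renewal hr hEC hEeq b hT
  simp only [E, hT, if_true] at this
  linarith

/-- Expectations of observables of the future of the path.  The hypothesis `hKp` says that
`K b t d` depends only on the path, started in `b` with durations `d`, from time `t` on.
Conditioning on the end of the first visit then gives the renewal equation, and with it the Markov
property: only the state at time `T`, not the elapsed duration, enters the right-hand side. -/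
lemma integral_durationLaw_eq {r : Bool → ℝ} (hr : ∀ b, 0 < r b)
    {K : Bool → ℝ → (Bool × ℕ → ℝ) → ℝ} {C : ℝ}
    (hKm : ∀ b, Measurable (fun q : ℝ × (Bool × ℕ → ℝ) => K b q.1 q.2))
    (hKC : ∀ b t d, |K b t d| ≤ C)
    (hKp : ∀ b t s d, 0 ≤ t → 0 ≤ s → (∀ p, 0 ≤ d p) → K b t (prependVisit b s d) =
      if t < s then K b 0 (prependVisit b (s - t) d) else K (!b) (t - s) d)
    (b : Bool) {T : ℝ} (hT : 0 ≤ T) :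
    ∫ d, K b T d ∂durationLaw r = stationaryMean r (fun c => ∫ d, K c 0 d ∂durationLaw r) +
      ((∫ d, K b 0 d ∂durationLaw r) - stationaryMean r (fun c => ∫ d, K c 0 d ∂durationLaw r)) *
        Real.exp (-((r true + r false) * T)) := by
  have := fun b => isProbabilityMeasure_expMeasure (hr b)
  have := isProbabilityMeasure_durationLaw hr
  have hbd {f : (Bool × ℕ → ℝ) → ℝ} (hf : ∀ d, |f d| ≤ C) : |∫ d, f d ∂durationLaw r| ≤ C := by
    have := norm_integral_le_of_norm_le_const (μ := durationLaw r) (f := f) (C := C)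
      (ae_of_all _ hf)
    simpa using this
  have hsplit (b : Bool) (t : ℝ) : ∫ d, K b t d ∂durationLaw r =
      ∫ s, ∫ d, K b t (prependVisit b s d) ∂durationLaw r ∂expMeasure (r b) := by
    have hKb : Measurable (K b t) := (hKm b).comp (measurable_const.prodMk measurable_id)
    conv_lhs => rw [← map_prependVisit hr b]
    rw [integral_map (measurable_prependVisit b).aemeasurable hKb.aestronglyMeasurable]
    refine integral_prod _ (Integrable.of_bound (C := C)
      (hKb.comp (measurable_prependVisit b)).aestronglyMeasurable (ae_of_all _ fun q => ?_))
    exact hKC b t _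
  refine eq_of_renewal hr (F := fun b t => ∫ d, K b t d ∂durationLaw r) (C := C) (fun b => ?_)
    (fun b t => hbd (hKC b t)) (fun b t ht => ?_) b hT
  · exact (hKm b).stronglyMeasurable.integral_prod_right'.measurable
  · have hφm : Measurable fun s => ∫ d, K b 0 (prependVisit b s d) ∂durationLaw r := by
      have : Measurable fun q : ℝ × (Bool × ℕ → ℝ) => K b 0 (prependVisit b q.1 q.2) :=
        (hKm b).comp (measurable_const.prodMk (measurable_prependVisit b))
      exact this.stronglyMeasurable.integral_prod_right'.measurable
    have hψm : Measurable fun s => ∫ d, K (!b) (t - s) d ∂durationLaw r := by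
      have : Measurable fun q : ℝ × (Bool × ℕ → ℝ) => K (!b) (t - q.1) q.2 :=
        (hKm (!b)).comp
          ((measurable_const.sub measurable_fst).prodMk measurable_snd)
      exact this.stronglyMeasurable.integral_prod_right'.measurable
    have h := integral_expMeasure_split (hr b) ht hφm hψm (fun s => hbd fun d => hKC _ _ _)
      (fun s => hbd fun d => hKC _ _ _)
    rw [← hsplit] at h
    change ∫ d, K b t d ∂durationLaw r = _
    rw [← h, hsplit]
    refine integral_congr_ae ?_
    filter_upwards [ae_expMeasure_pos (hr b)] with s hs
    have hd := ae_durationLaw_pos hr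
    by_cases hts : t < s
    · rw [if_pos hts]
      refine integral_congr_ae ?_
      filter_upwards [hd] with d hd
      rw [hKp b t s d ht hs.le fun p => (hd p).le, if_pos hts]
    · rw [if_neg hts]
      refine integral_congr_ae ?_
      filter_upwards [hd] with d hd
      rw [hKp b t s d ht hs.le fun p => (hd p).le, if_neg hts]

/-! ### A single pair -/

lemma idle_zero (b : Bool) {d : Bool × ℕ → ℝ} (hd : ∀ p, 0 < d p) :
    idle (b, d) 0 = if b = true then 0 else 1 := by
  have h1 : InFirstPhase b (Function.curry d) 0 := ⟨0, by simp [cycleStart], by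
    simpa [cycleStart] using hd (b, 0)⟩
  have h2 : ¬ InSecondPhase b (Function.curry d) 0 := by
    rintro ⟨n, hn, -⟩
    have := cycleStart_nonneg b (d := Function.curry d) (fun s k => (hd (s, k)).le) n
    have := hd (b, n)
    simp only [Function.curry_apply] at hn
    linarith
  cases b <;> simp [idle, contactProcess, InContact, h1, h2]

lemma measurable_idle_comp {α : Type*} [MeasurableSpace α] {g : α → Bool × (Bool × ℕ → ℝ)}
    {t : α → ℝ} (hg : Measurable g) (ht : Measurable t) :
    Measurable fun a => idle (g a) (t a) :=
  measurable_idle.comp (hg.prodMk ht)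

lemma abs_prod_le_one {κ : Type*} (s : Finset κ) {f : κ → ℝ} (h0 : ∀ i, 0 ≤ f i)
    (h1 : ∀ i, f i ≤ 1) : |∏ i ∈ s, f i| ≤ 1 := by
  rw [abs_of_nonneg (Finset.prod_nonneg fun i _ => h0 i)]
  exact Finset.prod_le_one (fun i _ => h0 i) fun i _ => h1 i

/-- The probability that the pair is out of contact at all the times `u l`, when it starts in the
state `b`. -/
noncomputable def idleProb {κ : Type*} [Fintype κ] (r : Bool → ℝ) (u : κ → ℝ) (b : Bool) : ℝ :=
  ∫ d, ∏ l, idle (b, d) (u l) ∂durationLaw r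

lemma integral_bool (ρ : Measure Bool) [IsProbabilityMeasure ρ] (c : Bool → ℝ) :
    ∫ b, c b ∂ρ = ρ.real {true} * c true + (1 - ρ.real {true}) * c false := by
  have h : ρ.real {false} = 1 - ρ.real {true} := by
    rw [← probReal_compl_eq_one_sub (measurableSet_singleton _)]
    congr 1
    ext b; cases b <;> simp
  rw [integral_fintype (.of_finite), Fintype.sum_bool, h]
  simp

/-- The joint probabilities of being out of contact relax exponentially to their stationary
values. -/
lemma integral_prod_idle {κ : Type*} [Fintype κ] {r : Bool → ℝ} (hr : ∀ b, 0 < r b)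
    (ρ : Measure Bool) [IsProbabilityMeasure ρ] {u : κ → ℝ} (hu : ∀ l, 0 ≤ u l) {T : ℝ}
    (hT : 0 ≤ T) :
    ∫ y, ∏ l, idle y (T + u l) ∂ρ.prod (durationLaw r) = stationaryMean r (idleProb r u) +
      ((∫ b, idleProb r u b ∂ρ) - stationaryMean r (idleProb r u)) *
        Real.exp (-((r true + r false) * T)) := by
  have := isProbabilityMeasure_durationLaw hr
  have hm : Measurable fun y : Bool × (Bool × ℕ → ℝ) => ∏ l, idle y (T + u l) :=
    Finset.measurable_prod _ fun l _ => measurable_idle_comp measurable_id measurable_const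
  have hb (y : Bool × (Bool × ℕ → ℝ)) (v : κ → ℝ) : |∏ l, idle y (v l)| ≤ 1 :=
    abs_prod_le_one _ (fun l => idle_nonneg _ _) fun l => idle_le_one _ _
  have key := integral_durationLaw_eq hr (K := fun b t d => ∏ l, idle (b, d) (t + u l)) (C := 1)
    (fun b => Finset.measurable_prod _ fun l _ => measurable_idle_comp (by fun_prop) (by fun_prop))
    (fun b t d => hb _ _) (fun b t s d ht hs hd => ?_)
  · simp only [zero_add] at key
    rw [integral_prod _ (Integrable.of_bound (C := 1) hm.aestronglyMeasurable
      (ae_of_all _ fun y => hb y _)), integral_bool, key true hT, key false hT, integral_bool]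
    unfold idleProb
    ring
  · by_cases h : t < s
    · rw [if_pos h]
      refine Finset.prod_congr rfl fun l _ => ?_
      rw [idle_prependVisit b hd (add_nonneg ht (hu l)),
        idle_prependVisit b hd (by simpa using hu l), zero_add]
      refine if_congr (by constructor <;> intro <;> linarith) rfl ?_
      congr 1; ring
    · rw [if_neg h]
      refine Finset.prod_congr rfl fun l _ => ?_
      rw [idle_prependVisit b hd (add_nonneg ht (hu l)), if_neg (by linarith [hu l])]
      congr 1; ring

lemma tendsto_integral_prod_idle {κ : Type*} [Fintype κ] {r : Bool → ℝ} (hr : ∀ b, 0 < r b)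
    (ρ : Measure Bool) [IsProbabilityMeasure ρ] {u : κ → ℝ} (hu : ∀ l, 0 ≤ u l) :
    Tendsto (fun T => ∫ y, ∏ l, idle y (T + u l) ∂ρ.prod (durationLaw r)) atTop
      (𝓝 (stationaryMean r (idleProb r u))) := by
  have hκ : 0 < r true + r false := add_pos (hr _) (hr _)
  have h1 : Tendsto (fun T : ℝ => Real.exp (-((r true + r false) * T))) atTop (𝓝 0) :=
    Real.tendsto_exp_neg_atTop_nhds_zero.comp (tendsto_id.const_mul_atTop hκ)
  have h2 := (h1.const_mul ((∫ b, idleProb r u b ∂ρ) - stationaryMean r (idleProb r u))).const_add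
    (stationaryMean r (idleProb r u))
  rw [mul_zero, add_zero] at h2
  refine h2.congr' ?_
  filter_upwards [eventually_ge_atTop 0] with T hT
  rw [integral_prod_idle hr ρ hu hT]

/-- `ρ` is the stationary law of the two-state chain that leaves the state `s` at rate `r s`. -/
def IsStationaryInit (r : Bool → ℝ) (ρ : Measure Bool) : Prop :=
  ρ.real {true} = r false / (r true + r false)

lemma exists_isStationaryInit {r : Bool → ℝ} (hr : ∀ b, 0 < r b) :
    ∃ ρ : Measure Bool, IsProbabilityMeasure ρ ∧ IsStationaryInit r ρ := by
  have hκ : 0 < r true + r false := add_pos (hr _) (hr _)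
  have h1 : 0 ≤ r true / (r true + r false) := (div_pos (hr _) hκ).le
  have h0 : 0 ≤ r false / (r true + r false) := (div_pos (hr _) hκ).le
  refine ⟨ENNReal.ofReal (r false / (r true + r false)) • Measure.dirac true +
    ENNReal.ofReal (r true / (r true + r false)) • Measure.dirac false, ⟨?_⟩, ?_⟩
  · simp only [Measure.add_apply, Measure.smul_apply, measure_univ, smul_eq_mul, mul_one]
    rw [← ENNReal.ofReal_add h0 h1, ← add_div, add_comm, div_self hκ.ne', ENNReal.ofReal_one]
  · simp [IsStationaryInit, Measure.real, h0]

lemma integral_prod_idle_stationary {κ : Type*} [Fintype κ] {r : Bool → ℝ} (hr : ∀ b, 0 < r b)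
    {ρ : Measure Bool} [IsProbabilityMeasure ρ] (hρ : IsStationaryInit r ρ) {u : κ → ℝ}
    (hu : ∀ l, 0 ≤ u l) {T : ℝ} (hT : 0 ≤ T) :
    ∫ y, ∏ l, idle y (T + u l) ∂ρ.prod (durationLaw r) = stationaryMean r (idleProb r u) := by
  have hκ : 0 < r true + r false := add_pos (hr _) (hr _)
  have h : ∫ b, idleProb r u b ∂ρ = stationaryMean r (idleProb r u) := by
    rw [integral_bool, hρ, stationaryMean]
    field_simp
    ring
  rw [integral_prod_idle hr ρ hu hT, h]
  ring

lemma idleProb_unit_zero {r : Bool → ℝ} (hr : ∀ b, 0 < r b) :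
    idleProb r (fun _ : Unit => (0 : ℝ)) = fun b => if b = true then 0 else 1 := by
  have := isProbabilityMeasure_durationLaw hr
  funext b
  have : ∫ d, ∏ _l : Unit, idle (b, d) 0 ∂durationLaw r =
      ∫ _d, (if b = true then 0 else 1 : ℝ) ∂durationLaw r := by
    refine integral_congr_ae ?_
    filter_upwards [ae_durationLaw_pos hr] with d hd
    simp [idle_zero b hd]
  rw [idleProb, this]
  simp

/-- A pair that is out of contact at time `0` is out of contact at time `u` with this
probability. -/
lemma integral_idle_false {r : Bool → ℝ} (hr : ∀ b, 0 < r b) {u : ℝ} (hu : 0 ≤ u) :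
    ∫ d, idle (false, d) u ∂durationLaw r =
      (r true + r false * Real.exp (-u * (r true + r false))) / (r true + r false) := by
  have := isProbabilityMeasure_durationLaw hr
  have hκ : 0 < r true + r false := add_pos (hr _) (hr _)
  have h := integral_prod_idle hr (Measure.dirac false) (u := fun _ : Unit => (0 : ℝ))
    (fun _ => le_rfl) hu
  have hm : Measurable fun y : Bool × (Bool × ℕ → ℝ) => idle y u :=
    measurable_idle_comp measurable_id measurable_const
  rw [idleProb_unit_zero hr] at h
  simp only [add_zero, Finset.univ_unique, Finset.prod_singleton, stationaryMean] at h
  rw [integral_prod _ (Integrable.of_bound (C := 1) hm.aestronglyMeasurable (ae_of_all _ fun y => by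
    rw [Real.norm_of_nonneg (idle_nonneg _ _)]; exact idle_le_one _ _)), integral_dirac,
    integral_dirac] at h
  rw [h, show -((r true + r false) * u) = -u * (r true + r false) by ring]
  simp
  field_simp
  ring

lemma integral_idle_stationary {r : Bool → ℝ} (hr : ∀ b, 0 < r b)
    {ρ : Measure Bool} [IsProbabilityMeasure ρ] (hρ : IsStationaryInit r ρ) {T : ℝ} (hT : 0 ≤ T) :
    ∫ y, idle y T ∂ρ.prod (durationLaw r) = r true / (r true + r false) := by
  have h := integral_prod_idle_stationary hr hρ (u := fun _ : Unit => (0 : ℝ))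
    (fun _ => le_rfl) hT
  simp only [add_zero, Finset.univ_unique, Finset.prod_singleton] at h
  rw [h, idleProb_unit_zero hr]
  simp [stationaryMean]

/-- The stationary probability of being out of contact at both times `S` and `T`. -/
lemma integral_idle_mul_idle_stationary {r : Bool → ℝ} (hr : ∀ b, 0 < r b)
    {ρ : Measure Bool} [IsProbabilityMeasure ρ] (hρ : IsStationaryInit r ρ) {S T : ℝ}
    (hS : 0 ≤ S) (hT : 0 ≤ T) :
    ∫ y, idle y S * idle y T ∂ρ.prod (durationLaw r) =
      r true / (r false + r true) ^ 2 *
        (r true + r false * Real.exp (-|S - T| * (r true + r false))) := by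
  wlog hST : S ≤ T generalizing S T
  · rw [abs_sub_comm, ← this hT hS (le_of_not_ge hST)]
    simp only [mul_comm]
  have hv : 0 ≤ T - S := sub_nonneg.2 hST
  -- viewed from time `S`, the two instants are `0` and `T - S`
  have h := integral_prod_idle_stationary hr hρ (u := ![0, T - S])
    (by intro l; fin_cases l <;> simp [hST]) hS
  have ht : idleProb r ![0, T - S] true = 0 := by
    refine integral_eq_zero_of_ae ?_
    filter_upwards [ae_durationLaw_pos hr] with d hd
    simp [Fin.prod_univ_two, idle_zero true hd]
  have hf : idleProb r ![0, T - S] false = ∫ d, idle (false, d) (T - S) ∂durationLaw r := by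
    refine integral_congr_ae ?_
    filter_upwards [ae_durationLaw_pos hr] with d hd
    simp [Fin.prod_univ_two, idle_zero false hd]
  have hκ : 0 < r true + r false := add_pos (hr _) (hr _)
  simp only [Fin.prod_univ_two, Matrix.cons_val_zero, Matrix.cons_val_one, add_zero,
    add_sub_cancel] at h
  rw [h, stationaryMean, ht, hf, integral_idle_false hr hv, abs_sub_comm, abs_of_nonneg hv,
    add_comm (r false) (r true)]
  field_simp
  ring

/-! ### Independent pairs -/

section Pairs

variable {ι : Type*} [Fintype ι]

/-- The joint law of the initial states and durations of independent pairs, when the initial state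
of the pair `j` has the law `ρ j` and its transition rates are `r j`. -/
noncomputable def pairsLaw (r : ι → Bool → ℝ) (ρ : ι → Measure Bool) :
    Measure (ι → Bool × (Bool × ℕ → ℝ)) :=
  Measure.pi fun j => (ρ j).prod (durationLaw (r j))

/-- The time in the window `[T, T + a]` during which no pair is in contact. -/
noncomputable def idleTime (a T : ℝ) (y : ι → Bool × (Bool × ℕ → ℝ)) : ℝ :=
  ∫ t in T..(T + a), ∏ j, idle (y j) t

lemma idleTime_eq {a : ℝ} (ha : 0 ≤ a) (T : ℝ) (y : ι → Bool × (Bool × ℕ → ℝ)) :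
    idleTime a T y = ∫ t, ∏ j, idle (y j) (T + t) ∂volume.restrict (Set.Ioc 0 a) := by
  rw [← intervalIntegral.integral_of_le ha,
    intervalIntegral.integral_comp_add_left (fun t => ∏ j, idle (y j) t), add_zero, idleTime]

lemma measurable_prod_idle : Measurable
    fun q : (ι → Bool × (Bool × ℕ → ℝ)) × ℝ => ∏ j, idle (q.1 j) q.2 :=
  Finset.measurable_prod _ fun j _ => measurable_idle_comp (by fun_prop) measurable_snd

lemma measurable_idleTime {a : ℝ} (ha : 0 ≤ a) (T : ℝ) :
    Measurable (idleTime a T : (ι → Bool × (Bool × ℕ → ℝ)) → ℝ) := by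
  simp only [funext (idleTime_eq (ι := ι) ha T)]
  have : Measurable fun q : (ι → Bool × (Bool × ℕ → ℝ)) × ℝ => ∏ j, idle (q.1 j) (T + q.2) :=
    measurable_prod_idle.comp (measurable_fst.prodMk (measurable_const.add measurable_snd))
  exact this.stronglyMeasurable.integral_prod_right'.measurable

lemma prod_idle_nonneg (y : ι → Bool × (Bool × ℕ → ℝ)) (t : ℝ) : 0 ≤ ∏ j, idle (y j) t :=
  Finset.prod_nonneg fun _ _ => idle_nonneg _ _

lemma prod_idle_le_one (y : ι → Bool × (Bool × ℕ → ℝ)) (t : ℝ) : ∏ j, idle (y j) t ≤ 1 :=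
  Finset.prod_le_one (fun _ _ => idle_nonneg _ _) fun _ _ => idle_le_one _ _

lemma intervalIntegrable_prod_idle (y : ι → Bool × (Bool × ℕ → ℝ)) (a b : ℝ) :
    IntervalIntegrable (fun t => ∏ j, idle (y j) t) volume a b := by
  rw [intervalIntegrable_iff]
  have : IsFiniteMeasure (volume.restrict (Set.uIoc a b)) :=
    ⟨by rw [Measure.restrict_apply_univ, Set.uIoc]; exact measure_Ioc_lt_top⟩
  exact Integrable.of_bound (C := 1) (measurable_prod_idle.comp
    (measurable_const.prodMk measurable_id)).aestronglyMeasurable (ae_of_all _ fun t => by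
      rw [Real.norm_of_nonneg (prod_idle_nonneg _ _)]; exact prod_idle_le_one _ _)

lemma idleTime_mem_Icc {a : ℝ} (ha : 0 ≤ a) (T : ℝ) (y : ι → Bool × (Bool × ℕ → ℝ)) :
    idleTime a T y ∈ Set.Icc 0 a := by
  have hT : T ≤ T + a := by linarith
  refine ⟨intervalIntegral.integral_nonneg hT fun t _ => prod_idle_nonneg _ _, ?_⟩
  have := intervalIntegral.integral_mono_on hT (intervalIntegrable_prod_idle y _ _)
    (intervalIntegrable_const (c := (1 : ℝ))) fun t _ => prod_idle_le_one y t
  simpa [idleTime] using this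

lemma isProbabilityMeasure_pairsLaw {r : ι → Bool → ℝ} (hr : ∀ j b, 0 < r j b)
    {ρ : ι → Measure Bool} [∀ j, IsProbabilityMeasure (ρ j)] :
    IsProbabilityMeasure (pairsLaw r ρ) := by
  have := fun j => isProbabilityMeasure_durationLaw (hr j)
  unfold pairsLaw; infer_instance

/-- Fubini and independence: the moments of the idle time are integrals, over the cube of side
`a`, of products over the pairs. -/
lemma integral_idleTime_pow {r : ι → Bool → ℝ} (hr : ∀ j b, 0 < r j b)
    {ρ : ι → Measure Bool} [∀ j, IsProbabilityMeasure (ρ j)] {a : ℝ} (ha : 0 ≤ a) (T : ℝ) (k : ℕ) :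
    ∫ y, idleTime a T y ^ k ∂pairsLaw r ρ =
      ∫ u, ∏ j, ∫ z, ∏ l, idle z (T + u l) ∂(ρ j).prod (durationLaw (r j))
        ∂Measure.pi fun _ : Fin k => volume.restrict (Set.Ioc 0 a) := by
  have := fun j => isProbabilityMeasure_durationLaw (hr j)
  have := isProbabilityMeasure_pairsLaw (ρ := ρ) hr
  have h1 (y : ι → Bool × (Bool × ℕ → ℝ)) : idleTime a T y ^ k =
      ∫ u, ∏ l, ∏ j, idle (y j) (T + u l)
        ∂Measure.pi fun _ : Fin k => volume.restrict (Set.Ioc 0 a) := by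
    rw [idleTime_eq ha, integral_fintype_prod_eq_pow (fun t => ∏ j, idle (y j) (T + t)),
      Fintype.card_fin]
  simp only [h1]
  rw [integral_integral_swap]
  · refine integral_congr_ae (ae_of_all _ fun u => ?_)
    change ∫ y, ∏ l, ∏ j, idle (y j) (T + u l) ∂pairsLaw r ρ = _
    simp only [Finset.prod_comm (s := (Finset.univ : Finset (Fin k)))]
    exact integral_fintype_prod_eq_prod (fun j z => ∏ l, idle z (T + u l))
  · refine Integrable.of_bound (C := 1) (Measurable.aestronglyMeasurable ?_) (ae_of_all _ fun q => ?_)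
    · exact Finset.measurable_prod _ fun l _ => Finset.measurable_prod _ fun j _ =>
        measurable_idle_comp (by fun_prop) (by fun_prop)
    · exact abs_prod_le_one _ (fun l => prod_idle_nonneg _ _) fun l => prod_idle_le_one _ _

lemma ae_pi_restrict_Ioc_nonneg (a : ℝ) (k : ℕ) :
    ∀ᵐ u ∂Measure.pi fun _ : Fin k => volume.restrict (Set.Ioc 0 a), ∀ l, 0 ≤ u l := by
  rw [ae_all_iff]
  intro l
  have h : ∀ᵐ t ∂volume.restrict (Set.Ioc 0 a), (0 : ℝ) ≤ t :=
    (ae_restrict_mem measurableSet_Ioc).mono fun t ht => ht.1.le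
  exact (Measure.quasiMeasurePreserving_eval
    (fun _ : Fin k => volume.restrict (Set.Ioc 0 a)) l).ae h

/-- For stationary pairs the moments of the idle time do not depend on the start of the window; they
are the limits in `tendsto_integral_idleTime_pow`. -/
lemma integral_idleTime_pow_stationary {r : ι → Bool → ℝ} (hr : ∀ j b, 0 < r j b)
    {ρ : ι → Measure Bool} [∀ j, IsProbabilityMeasure (ρ j)]
    (hρ : ∀ j, IsStationaryInit (r j) (ρ j)) {a : ℝ} (ha : 0 ≤ a) {T : ℝ} (hT : 0 ≤ T) (k : ℕ) :
    ∫ y, idleTime a T y ^ k ∂pairsLaw r ρ =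
      ∫ u, ∏ j, stationaryMean (r j) (idleProb (r j) u)
        ∂Measure.pi fun _ : Fin k => volume.restrict (Set.Ioc 0 a) := by
  rw [integral_idleTime_pow hr ha]
  refine integral_congr_ae ?_
  filter_upwards [ae_pi_restrict_Ioc_nonneg a k] with u hu
  exact Finset.prod_congr rfl fun j _ => integral_prod_idle_stationary (hr j) (hρ j) hu hT

lemma tendsto_integral_idleTime_pow {r : ι → Bool → ℝ} (hr : ∀ j b, 0 < r j b)
    {ρ : ι → Measure Bool} [∀ j, IsProbabilityMeasure (ρ j)] {a : ℝ} (ha : 0 ≤ a) (k : ℕ) :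
    Tendsto (fun T => ∫ y, idleTime a T y ^ k ∂pairsLaw r ρ) atTop
      (𝓝 (∫ u, ∏ j, stationaryMean (r j) (idleProb (r j) u)
        ∂Measure.pi fun _ : Fin k => volume.restrict (Set.Ioc 0 a))) := by
  have := fun j => isProbabilityMeasure_durationLaw (hr j)
  simp only [integral_idleTime_pow hr ha]
  refine tendsto_integral_filter_of_dominated_convergence (fun _ => 1)
    (Eventually.of_forall fun T => Measurable.aestronglyMeasurable ?_)
    (Eventually.of_forall fun T => ae_of_all _ fun u => ?_) (integrable_const _) ?_
  · refine Finset.measurable_prod _ fun j _ => ?_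
    have : Measurable fun q : (Fin k → ℝ) × (Bool × (Bool × ℕ → ℝ)) =>
        ∏ l, idle q.2 (T + q.1 l) :=
      Finset.measurable_prod _ fun l _ => measurable_idle_comp measurable_snd (by fun_prop)
    exact this.stronglyMeasurable.integral_prod_right'.measurable
  · refine abs_prod_le_one _ (fun j => integral_nonneg fun z =>
      Finset.prod_nonneg fun l _ => idle_nonneg _ _) fun j => ?_
    have h := norm_integral_le_of_norm_le_const (μ := (ρ j).prod (durationLaw (r j)))
      (f := fun z => ∏ l, idle z (T + u l)) (C := 1)
      (ae_of_all _ fun z => abs_prod_le_one _ (fun l => idle_nonneg _ _) fun l => idle_le_one _ _)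
    simpa using (le_abs_self _).trans h
  · filter_upwards [ae_pi_restrict_Ioc_nonneg a k] with u hu
    exact tendsto_finsetProd _ fun j _ => tendsto_integral_prod_idle (hr j) (ρ j) hu

end Pairs

/-! ### First and second stationary moments -/

/-- `∫₀ᵃ∫₀ᵃ g(|s - t|) dt ds`, computed by integration by parts from the primitive of `g`. -/
lemma integral_integral_abs_sub {g : ℝ → ℝ} (hg : Continuous g) (a : ℝ) (ha : 0 ≤ a) :
    ∫ s in (0 : ℝ)..a, ∫ t in (0 : ℝ)..a, g |s - t| =
      2 * ∫ v in (0 : ℝ)..a, (a - v) * g v := by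
  set G : ℝ → ℝ := fun s => ∫ v in (0 : ℝ)..s, g v with hG
  have hGd (s : ℝ) : HasDerivAt G (g s) s :=
    intervalIntegral.integral_hasDerivAt_right (hg.intervalIntegrable _ _)
      (hg.stronglyMeasurableAtFilter _ _) hg.continuousAt
  have hGc : Continuous G := continuous_iff_continuousAt.2 fun s => (hGd s).continuousAt
  have hinner : ∀ s ∈ Set.uIcc 0 a, ∫ t in (0 : ℝ)..a, g |s - t| = G s + G (a - s) := by
    intro s hs
    rw [Set.uIcc_of_le ha] at hs
    have hc : Continuous fun t => g |s - t| := by fun_prop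
    rw [← intervalIntegral.integral_add_adjacent_intervals (b := s)
      (hc.intervalIntegrable _ _) (hc.intervalIntegrable _ _)]
    congr 1
    · have h1 : ∫ t in (0 : ℝ)..s, g |s - t| = ∫ t in (0 : ℝ)..s, g (s - t) := by
        refine intervalIntegral.integral_congr fun t ht => ?_
        rw [Set.uIcc_of_le hs.1] at ht
        simp only [abs_of_nonneg (sub_nonneg.2 ht.2)]
      rw [h1, intervalIntegral.integral_comp_sub_left g s]
      simp [hG]
    · have h1 : ∫ t in s..a, g |s - t| = ∫ t in s..a, g (t - s) := by
        refine intervalIntegral.integral_congr fun t ht => ?_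
        rw [Set.uIcc_of_le hs.2] at ht
        simp only [abs_sub_comm s t, abs_of_nonneg (sub_nonneg.2 ht.1)]
      rw [h1, intervalIntegral.integral_comp_sub_right g s]
      simp [hG]
  rw [intervalIntegral.integral_congr hinner, intervalIntegral.integral_add
    (hGc.intervalIntegrable _ _) ((by fun_prop : Continuous fun s => G (a - s)).intervalIntegrable
      _ _), intervalIntegral.integral_comp_sub_left G a]
  have hparts := intervalIntegral.integral_eq_sub_of_hasDerivAt (a := 0) (b := a)
    (f := fun v => (a - v) * G v) (f' := fun v => -1 * G v + (a - v) * g v)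
    (fun v _ => ((hasDerivAt_id' v).const_sub a).mul (hGd v))
    (by apply Continuous.intervalIntegrable; fun_prop)
  rw [intervalIntegral.integral_add (by apply Continuous.intervalIntegrable; fun_prop)
    (by apply Continuous.intervalIntegrable; fun_prop), intervalIntegral.integral_const_mul]
    at hparts
  have hG0 : G 0 = 0 := by simp [hG]
  simp only [sub_self, zero_mul, hG0, mul_zero, sub_zero] at hparts ⊢
  linarith

section StationaryMoments

variable {ι : Type*} [Fintype ι]

lemma integral_idleTime_stationary {r : ι → Bool → ℝ} (hr : ∀ j b, 0 < r j b)
    {ρ : ι → Measure Bool} [∀ j, IsProbabilityMeasure (ρ j)]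
    (hρ : ∀ j, IsStationaryInit (r j) (ρ j)) {a : ℝ} (ha : 0 ≤ a) {T : ℝ} (hT : 0 ≤ T) :
    ∫ y, idleTime a T y ∂pairsLaw r ρ = a * ∏ j, r j true / (r j true + r j false) := by
  have h := integral_idleTime_pow (ρ := ρ) hr ha T 1
  simp only [pow_one] at h
  have hc : ∀ᵐ u ∂Measure.pi fun _ : Fin 1 => volume.restrict (Set.Ioc 0 a),
      ∏ j, ∫ z, ∏ l, idle z (T + u l) ∂(ρ j).prod (durationLaw (r j)) =
        ∏ j, r j true / (r j true + r j false) := by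
    filter_upwards [ae_pi_restrict_Ioc_nonneg a 1] with u hu
    refine Finset.prod_congr rfl fun j _ => ?_
    simp only [Finset.univ_unique, Finset.prod_singleton]
    exact integral_idle_stationary (hr j) (hρ j) (add_nonneg hT (hu _))
  rw [h, integral_congr_ae hc]
  simp [Measure.real, Measure.pi_univ, ha]

lemma integral_idleTime_sq_stationary {r : ι → Bool → ℝ} (hr : ∀ j b, 0 < r j b)
    {ρ : ι → Measure Bool} [∀ j, IsProbabilityMeasure (ρ j)]
    (hρ : ∀ j, IsStationaryInit (r j) (ρ j)) {a : ℝ} (ha : 0 ≤ a) {T : ℝ} (hT : 0 ≤ T) :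
    ∫ y, idleTime a T y ^ 2 ∂pairsLaw r ρ =
      2 * ∫ v in (0 : ℝ)..a, (a - v) * ∏ j, (r j true / (r j false + r j true) ^ 2 *
        (r j true + r j false * Real.exp (-v * (r j true + r j false)))) := by
  set g : ℝ → ℝ := fun v => ∏ j, (r j true / (r j false + r j true) ^ 2 *
        (r j true + r j false * Real.exp (-v * (r j true + r j false)))) with hg
  have hgc : Continuous g := by fun_prop
  have hc : ∀ᵐ u ∂Measure.pi fun _ : Fin 2 => volume.restrict (Set.Ioc 0 a),
      ∏ j, ∫ z, ∏ l, idle z (T + u l) ∂(ρ j).prod (durationLaw (r j)) = g |u 0 - u 1| := by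
    filter_upwards [ae_pi_restrict_Ioc_nonneg a 2] with u hu
    refine Finset.prod_congr rfl fun j _ => ?_
    simp only [Fin.prod_univ_two]
    rw [integral_idle_mul_idle_stationary (hr j) (hρ j) (add_nonneg hT (hu _))
      (add_nonneg hT (hu _)), add_sub_add_left_eq_sub]
  have hmp := measurePreserving_finTwoArrow (volume.restrict (Set.Ioc (0 : ℝ) a))
  have hcov := hmp.integral_comp' (fun q : ℝ × ℝ => g |q.1 - q.2|)
  have hint : Integrable (fun q : ℝ × ℝ => g |q.1 - q.2|)
      ((volume.restrict (Set.Ioc (0 : ℝ) a)).prod (volume.restrict (Set.Ioc (0 : ℝ) a))) := by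
    rw [Measure.prod_restrict, ← Measure.volume_eq_prod]
    have hcont : Continuous fun q : ℝ × ℝ => g |q.1 - q.2| := by fun_prop
    exact (hcont.continuousOn.integrableOn_compact (isCompact_Icc.prod isCompact_Icc)).mono_set
      (Set.prod_mono Set.Ioc_subset_Icc_self Set.Ioc_subset_Icc_self)
  rw [integral_idleTime_pow hr ha, integral_congr_ae hc, ← integral_integral_abs_sub hgc a ha]
  simp only [intervalIntegral.integral_of_le ha]
  rw [← integral_prod _ hint, ← hcov]
  rfl

end StationaryMoments

/-! ### The method of moments on a compact interval -/

section Moments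

variable {Ω : Type*} [MeasurableSpace Ω] {μ : Measure Ω} [IsProbabilityMeasure μ] {X : Ω → ℝ}
  {a b : ℝ}

lemma integrable_comp_of_mem_Icc (hX : Measurable X) (hXI : ∀ ω, X ω ∈ Set.Icc a b)
    {g : ℝ → ℝ} (hg : Continuous g) : Integrable (fun ω => g (X ω)) μ := by
  obtain ⟨C, hC⟩ := isCompact_Icc.exists_bound_of_continuousOn (s := Set.Icc a b) hg.continuousOn
  exact Integrable.of_bound (hg.measurable.comp hX).aestronglyMeasurable C
    (ae_of_all _ fun ω => hC _ (hXI ω))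

lemma integral_polynomial_eval (hX : Measurable X) (hXI : ∀ ω, X ω ∈ Set.Icc a b)
    (p : Polynomial ℝ) : ∫ ω, p.eval (X ω) ∂μ =
      ∑ k ∈ Finset.range (p.natDegree + 1), p.coeff k * ∫ ω, X ω ^ k ∂μ := by
  simp only [Polynomial.eval_eq_sum_range]
  rw [integral_finsetSum _ fun k _ => integrable_comp_of_mem_Icc hX hXI
    (g := fun x => p.coeff k * x ^ k) (by fun_prop)]
  simp only [integral_const_mul]

lemma abs_integral_polynomial_sub_le (hX : Measurable X) (hXI : ∀ ω, X ω ∈ Set.Icc a b)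
    {f : ℝ → ℝ} (hf : Continuous f) (p : Polynomial ℝ) {ε : ℝ}
    (hp : ∀ x ∈ Set.Icc a b, |p.eval x - f x| < ε) :
    |∫ ω, p.eval (X ω) ∂μ - ∫ ω, f (X ω) ∂μ| ≤ ε := by
  rw [← integral_sub (integrable_comp_of_mem_Icc hX hXI p.continuous)
    (integrable_comp_of_mem_Icc hX hXI hf)]
  have := norm_integral_le_of_norm_le_const (μ := μ)
    (f := fun ω => p.eval (X ω) - f (X ω)) (ae_of_all _ fun ω => (hp _ (hXI ω)).le)
  simpa using this

end Moments

/-- Random variables with values in a fixed compact interval converge in distribution as soon as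
all their moments converge to those of the limit: by Weierstrass, polynomials are uniformly dense
in the continuous functions on the interval. -/
lemma tendstoInDistribution_of_tendsto_moments {Ω Ω' γ : Type*} [MeasurableSpace Ω]
    [MeasurableSpace Ω'] {μ : Measure Ω} [IsProbabilityMeasure μ] {μ' : Measure Ω'}
    [IsProbabilityMeasure μ'] {l : Filter γ} {X : γ → Ω → ℝ} {X' : Ω' → ℝ} {a b : ℝ}
    (hX : ∀ i, Measurable (X i)) (hX' : Measurable X') (hXI : ∀ i ω, X i ω ∈ Set.Icc a b)
    (hXI' : ∀ ω, X' ω ∈ Set.Icc a b)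
    (hmom : ∀ k : ℕ, Tendsto (fun i => ∫ ω, X i ω ^ k ∂μ) l (𝓝 (∫ ω, X' ω ^ k ∂μ'))) :
    TendstoInDistribution X l X' (fun _ => μ) μ' := by
  refine ⟨fun i => (hX i).aemeasurable, hX'.aemeasurable, ?_⟩
  refine ProbabilityMeasure.tendsto_iff_forall_integral_tendsto.2 fun f => ?_
  have hpoly (p : Polynomial ℝ) : Tendsto (fun i => ∫ ω, p.eval (X i ω) ∂μ) l
      (𝓝 (∫ ω, p.eval (X' ω) ∂μ')) := by
    simp only [integral_polynomial_eval (hX _) (hXI _), integral_polynomial_eval hX' hXI']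
    exact tendsto_finsetSum _ fun k _ => (hmom k).const_mul _
  have hfm : Measurable f := f.continuous.measurable
  suffices h : Tendsto (fun i => ∫ ω, f (X i ω) ∂μ) l (𝓝 (∫ ω, f (X' ω) ∂μ')) by
    simpa only [ProbabilityMeasure.coe_mk, integral_map (hX _).aemeasurable
      hfm.aestronglyMeasurable, integral_map hX'.aemeasurable hfm.aestronglyMeasurable] using h
  rw [Metric.tendsto_nhds]
  intro ε hε
  obtain ⟨p, hp⟩ := exists_polynomial_near_of_continuousOn a b f f.continuous.continuousOn (ε / 3)
    (by positivity)
  filter_upwards [Metric.tendsto_nhds.1 (hpoly p) (ε / 3) (by positivity)] with i hi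
  have h1 := abs_integral_polynomial_sub_le (μ := μ) (hX i) (hXI i) f.continuous p hp
  have h2 := abs_integral_polynomial_sub_le (μ := μ') hX' hXI' f.continuous p hp
  rw [Real.dist_eq] at hi ⊢
  rw [abs_le] at h1 h2
  rw [abs_lt] at hi ⊢
  constructor <;> linarith [h1.1, h1.2, h2.1, h2.2, hi.1, hi.2]

lemma integral_const_sub_of_mem_Icc {Ω : Type*} [MeasurableSpace Ω] {μ : Measure Ω}
    [IsProbabilityMeasure μ] {V : Ω → ℝ} (hV : Measurable V) {a : ℝ}
    (hVI : ∀ ω, V ω ∈ Set.Icc 0 a) : ∫ ω, (a - V ω) ∂μ = a - ∫ ω, V ω ∂μ := by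
  have h := (memLp_of_bounded (ae_of_all μ hVI) hV.aestronglyMeasurable 1).integrable le_rfl
  rw [integral_sub (integrable_const _) h]
  simp

lemma variance_const_sub_of_mem_Icc {Ω : Type*} [MeasurableSpace Ω] {μ : Measure Ω}
    [IsProbabilityMeasure μ] {V : Ω → ℝ} (hV : Measurable V) {a : ℝ}
    (hVI : ∀ ω, V ω ∈ Set.Icc 0 a) :
    Var[fun ω => a - V ω; μ] = ∫ ω, V ω ^ 2 ∂μ - (∫ ω, V ω ∂μ) ^ 2 := by
  rw [variance_const_sub hV.aestronglyMeasurable, variance_eq_sub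
    (memLp_of_bounded (ae_of_all μ hVI) hV.aestronglyMeasurable 2)]
  rfl

lemma memLp_const_sub_of_mem_Icc {Ω : Type*} [MeasurableSpace Ω] {μ : Measure Ω}
    [IsProbabilityMeasure μ] {V : Ω → ℝ} (hV : Measurable V) {a : ℝ}
    (hVI : ∀ ω, V ω ∈ Set.Icc 0 a) : MemLp (fun ω => a - V ω) 2 μ :=
  memLp_of_bounded (a := 0) (b := a) (ae_of_all _ fun ω => ⟨by linarith [(hVI ω).2],
    by linarith [(hVI ω).1]⟩) (hV.const_sub a).aestronglyMeasurable 2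

/-! ### The mobility model -/

section Model

variable {Ω U F : Type*}

/-- The users other than `i` that cache the file `f`. -/
abbrev Cachers (x : U → F → Bool) (i : U) (f : F) : Type _ := {j : U // j ≠ i ∧ x j f = true}

/-- The rates at which the pair `e` leaves its two states: contacts end at rate `lamC e`, periods
without contact at rate `lamI e`. -/
def pairRate (lamC lamI : Sym2 U → ℝ) (e : Sym2 U) : Bool → ℝ
  | true => lamC e
  | false => lamI e

/-- The initial states and durations of the pairs formed by `i` and the other users that cache
`f`. -/
def pairData (Z : Sym2 U → Ω → Bool) (D : Sym2 U → Bool → ℕ → Ω → ℝ) (x : U → F → Bool) (i : U)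
    (f : F) (ω : Ω) (j : Cachers x i f) : Bool × (Bool × ℕ → ℝ) :=
  (Z s(i, (j : U)) ω, fun p => D s(i, (j : U)) p.1 p.2 ω)

lemma Cachers.not_isDiag {x : U → F → Bool} {i : U} {f : F} (j : Cachers x i f) :
    ¬ (s(i, (j : U))).IsDiag := by
  rw [Sym2.mk_isDiag_iff]
  exact fun h => j.2.1 h.symm

lemma pairRate_pos [MeasurableSpace Ω] {P : Measure Ω} {lamC lamI : Sym2 U → ℝ}
    {Z : Sym2 U → Ω → Bool} {D : Sym2 U → Bool → ℕ → Ω → ℝ} (hM : IsMobilityModel P lamC lamI Z D)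
    {x : U → F → Bool} {i : U} {f : F} (j : Cachers x i f) (b : Bool) :
    0 < pairRate lamC lamI s(i, (j : U)) b := by
  cases b
  · exact hM.lamI_pos _ j.not_isDiag
  · exact hM.lamC_pos _ j.not_isDiag

lemma measurable_pairData [MeasurableSpace Ω] {P : Measure Ω} {lamC lamI : Sym2 U → ℝ}
    {Z : Sym2 U → Ω → Bool} {D : Sym2 U → Bool → ℕ → Ω → ℝ} (hM : IsMobilityModel P lamC lamI Z D)
    (x : U → F → Bool) (i : U) (f : F) : Measurable (pairData Z D x i f) :=
  measurable_pi_lambda _ fun j => (hM.measurable_init _ j.not_isDiag).prodMk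
    (measurable_pi_lambda _ fun p => hM.measurable_dur _ j.not_isDiag p.1 p.2)

/-- Distinct users `j` form distinct pairs with `i`, so their data are independent. -/
lemma map_pairData [Fintype U] [DecidableEq U] [MeasurableSpace Ω] {P : Measure Ω}
    [IsProbabilityMeasure P] {lamC lamI : Sym2 U → ℝ}
    {Z : Sym2 U → Ω → Bool} {D : Sym2 U → Bool → ℕ → Ω → ℝ} (hM : IsMobilityModel P lamC lamI Z D)
    (x : U → F → Bool) (i : U) (f : F) :
    P.map (pairData Z D x i f) =
      pairsLaw (fun j : Cachers x i f => pairRate lamC lamI s(i, (j : U)))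
        (fun j => P.map (Z s(i, (j : U)))) := by
  have hinj : Function.Injective fun j : Cachers x i f =>
      (⟨s(i, (j : U)), j.not_isDiag⟩ : {e : Sym2 U // ¬ e.IsDiag}) := by
    intro j j' h
    exact Subtype.ext (Sym2.congr_right.1 (Subtype.ext_iff.1 h))
  have hind := hM.indep_pairs.precomp hinj
  have hm := measurable_pairData hM x i f
  rw [pairsLaw]
  refine ((iIndepFun_iff_map_fun_eq_pi_map fun j =>
    ((measurable_pi_apply j).comp hm).aemeasurable).1 hind).trans ?_
  congr 1
  funext j
  have he := j.not_isDiag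
  have hDm : ∀ p : Bool × ℕ, Measurable fun ω => D s(i, (j : U)) p.1 p.2 ω :=
    fun p => hM.measurable_dur _ he p.1 p.2
  refine ((indepFun_iff_map_prod_eq_prod_map_map (hM.measurable_init _ he).aemeasurable
    (measurable_pi_lambda _ hDm).aemeasurable).1 (hM.indep_init _ he)).trans ?_
  congr 1
  rw [(iIndepFun_iff_map_fun_eq_infinitePi_map hDm).1 (hM.indep_dur _ he), durationLaw]
  congr 1
  funext p
  rcases p with ⟨_ | _, k⟩
  · exact hM.law_inter _ he k
  · exact hM.law_contact _ he k

variable [Fintype U] [DecidableEq U]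

lemma downloadProcess_eq (Z : Sym2 U → Ω → Bool) (D : Sym2 U → Bool → ℕ → Ω → ℝ)
    (x : U → F → Bool) (i : U) (f : F) (t : ℝ) (ω : Ω) :
    downloadProcess Z D x i f t ω = 1 - ∏ j, idle (pairData Z D x i f ω j) t := by
  unfold downloadProcess
  rw [Finset.prod_subtype (p := fun j => j ≠ i ∧ x j f = true) _ (by simp)]
  rfl

lemma windowTime_eq (Z : Sym2 U → Ω → Bool) (D : Sym2 U → Bool → ℕ → Ω → ℝ)
    (x : U → F → Bool) (i : U) (f : F) (Td Tr : ℝ) (ω : Ω) :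
    windowTime Z D x i f Td Tr ω = Td - idleTime Td Tr (pairData Z D x i f ω) := by
  unfold windowTime
  simp only [downloadProcess_eq]
  rw [intervalIntegral.integral_sub intervalIntegrable_const (intervalIntegrable_prod_idle _ _ _),
    idleTime]
  simp

lemma prod_cachers {x : U → F → Bool} {i : U} {f : F} (hx : x i f = false) (g : U → ℝ) :
    ∏ j ∈ Finset.univ.filter (fun j => x j f = true), g j = ∏ j : Cachers x i f, g j := by
  refine Finset.prod_subtype (p := fun j => j ≠ i ∧ x j f = true) _ (fun j => ?_) g
  simp only [Finset.mem_filter, Finset.mem_univ, true_and]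
  refine ⟨fun h => ⟨?_, h⟩, fun h => h.2⟩
  rintro rfl
  simp [hx] at h

/-- The second moment minus the square of the first moment of the stationary idle time. -/
lemma commVar_eq (lamC lamI : Sym2 U → ℝ) {x : U → F → Bool} {i : U} {f : F}
    (hx : x i f = false) {r : Cachers x i f → Bool → ℝ}
    (hr : r = fun j : Cachers x i f => pairRate lamC lamI s(i, (j : U))) (Td : ℝ) :
    commVar lamC lamI x i f Td =
      2 * (∫ v in (0 : ℝ)..Td, (Td - v) * ∏ j, (r j true / (r j false + r j true) ^ 2 *
        (r j true + r j false * Real.exp (-v * (r j true + r j false))))) -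
      (Td * ∏ j, r j true / (r j true + r j false)) ^ 2 := by
  subst hr
  simp only [commVar, prod_cachers hx, mul_pow, Finset.prod_pow, pairRate]

lemma commMean_eq (lamC lamI : Sym2 U → ℝ) {x : U → F → Bool} {i : U} {f : F}
    (hx : x i f = false) {r : Cachers x i f → Bool → ℝ}
    (hr : r = fun j : Cachers x i f => pairRate lamC lamI s(i, (j : U))) (Td : ℝ) :
    commMean lamC lamI x i f Td = Td - Td * ∏ j, r j true / (r j true + r j false) := by
  subst hr
  simp only [commMean, prod_cachers hx, pairRate, mul_sub, mul_one]

end Model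

theorem lemma1 {Ω U F : Type*} [MeasurableSpace Ω] (P : Measure Ω) [IsProbabilityMeasure P]
    [Fintype U] [DecidableEq U]
    (lamC lamI : Sym2 U → ℝ) (Z : Sym2 U → Ω → Bool) (D : Sym2 U → Bool → ℕ → Ω → ℝ)
    (hM : IsMobilityModel P lamC lamI Z D)
    (x : U → F → Bool) (i : U) (f : F) (hx : x i f = false) (Td : ℝ) (hTd : 0 < Td) :
    -- the communication time exists as a limit in distribution
    (∃ (ν : Measure ℝ) (_ : IsProbabilityMeasure ν), IsCommunicationTime P Z D x i f Td ν id) ∧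
    -- its mean and its variance
    (∀ (Ω' : Type*) [MeasurableSpace Ω'] (P' : Measure Ω') [IsProbabilityMeasure P'] (Tc : Ω' → ℝ),
      IsCommunicationTime P Z D x i f Td P' Tc →
        MemLp Tc 2 P' ∧ P'[Tc] = commMean lamC lamI x i f Td ∧
          Var[Tc; P'] = commVar lamC lamI x i f Td) ∧
    -- they are the limits of the mean and the variance as the request time tends to infinity
    Tendsto (fun Tr : ℝ => P[windowTime Z D x i f Td Tr]) atTop
      (𝓝 (commMean lamC lamI x i f Td)) ∧
    Tendsto (fun Tr : ℝ => Var[windowTime Z D x i f Td Tr; P]) atTop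
      (𝓝 (commVar lamC lamI x i f Td)) ∧
    -- if the contact processes are stationary, the formulas are exact for every request time
    ((∀ j, j ≠ i → P.real {ω | Z s(i, j) ω = true} =
        lamI s(i, j) / (lamC s(i, j) + lamI s(i, j))) →
      ∀ Tr : ℝ, 0 ≤ Tr →
        MemLp (windowTime Z D x i f Td Tr) 2 P ∧
        P[windowTime Z D x i f Td Tr] = commMean lamC lamI x i f Td ∧
        Var[windowTime Z D x i f Td Tr; P] = commVar lamC lamI x i f Td) := by
  set r : Cachers x i f → Bool → ℝ := fun j => pairRate lamC lamI s(i, (j : U)) with hr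
  have hr0 : ∀ j b, 0 < r j b := pairRate_pos hM
  set ρ : Cachers x i f → Measure Bool := fun j => P.map (Z s(i, (j : U))) with hρ
  have hρP : ∀ j, IsProbabilityMeasure (ρ j) := fun j =>
    Measure.isProbabilityMeasure_map (hM.measurable_init _ j.not_isDiag).aemeasurable
  have hlaw : P.map (pairData Z D x i f) = pairsLaw r ρ := map_pairData hM x i f
  have hYm := measurable_pairData hM x i f
  -- the idle time in the window, under `P` and under the stationary law
  set V : ℝ → Ω → ℝ := fun Tr ω => idleTime Td Tr (pairData Z D x i f ω) with hV
  have hVm (Tr : ℝ) : Measurable (V Tr) := (measurable_idleTime hTd.le Tr).comp hYm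
  have hVI (Tr : ℝ) (ω : Ω) : V Tr ω ∈ Set.Icc 0 Td := idleTime_mem_Icc hTd.le _ _
  have hW (Tr : ℝ) : windowTime Z D x i f Td Tr = fun ω => Td - V Tr ω :=
    funext fun ω => windowTime_eq Z D x i f Td Tr ω
  have hVpow (Tr : ℝ) (k : ℕ) :
      ∫ ω, V Tr ω ^ k ∂P = ∫ y, idleTime Td Tr y ^ k ∂pairsLaw r ρ := by
    rw [← hlaw, integral_map hYm.aemeasurable
      ((measurable_idleTime hTd.le Tr).pow_const k).aestronglyMeasurable]
  choose π hπP hπ using fun j => exists_isStationaryInit (hr0 j)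
  have := isProbabilityMeasure_pairsLaw (ρ := π) hr0
  set V' : (Cachers x i f → Bool × (Bool × ℕ → ℝ)) → ℝ := idleTime Td 0 with hV'
  have hV'm : Measurable V' := measurable_idleTime hTd.le 0
  have hV'I (y) : V' y ∈ Set.Icc 0 Td := idleTime_mem_Icc hTd.le _ _
  have hmom (k : ℕ) : Tendsto (fun Tr => ∫ ω, V Tr ω ^ k ∂P) atTop
      (𝓝 (∫ y, V' y ^ k ∂pairsLaw r π)) := by
    simp only [hVpow]
    rw [integral_idleTime_pow_stationary hr0 hπ hTd.le le_rfl]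
    exact tendsto_integral_idleTime_pow hr0 hTd.le k
  have hmean : ∫ y, (Td - V' y) ∂pairsLaw r π = commMean lamC lamI x i f Td := by
    rw [integral_const_sub_of_mem_Icc hV'm hV'I,
      integral_idleTime_stationary hr0 hπ hTd.le le_rfl, commMean_eq lamC lamI hx hr]
  have hvar : Var[fun y => Td - V' y; pairsLaw r π] = commVar lamC lamI x i f Td := by
    rw [variance_const_sub_of_mem_Icc hV'm hV'I,
      integral_idleTime_stationary hr0 hπ hTd.le le_rfl,
      integral_idleTime_sq_stationary hr0 hπ hTd.le le_rfl, commVar_eq lamC lamI hx hr]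
  have hdist : TendstoInDistribution (fun Tr => windowTime Z D x i f Td Tr) atTop
      (fun y => Td - V' y) (fun _ => P) (pairsLaw r π) := by
    simp only [hW]
    exact (tendstoInDistribution_of_tendsto_moments hVm hV'm hVI hV'I hmom).continuous_comp
      (g := fun v => Td - v) (by fun_prop)
  have hmap := hdist.aemeasurable_limit
  refine ⟨⟨(pairsLaw r π).map fun y => Td - V' y, Measure.isProbabilityMeasure_map hmap, ?_⟩,
    ?_, ?_, ?_, ?_⟩
  · have := Measure.isProbabilityMeasure_map hmap
    refine ⟨hdist.forall_aemeasurable, aemeasurable_id, ?_⟩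
    convert! hdist.tendsto using 2
    exact congrArg 𝓝 (Subtype.ext Measure.map_id)
  · intro Ω' _ P' _ Tc hTc
    have hid : IdentDistrib Tc (fun y => Td - V' y) P' (pairsLaw r π) :=
      ⟨hTc.aemeasurable_limit, hmap, tendstoInDistribution_unique _ hTc hdist⟩
    refine ⟨hid.memLp_iff.2 ?_, hid.integral_eq.trans hmean, hid.variance_eq.trans hvar⟩
    exact memLp_const_sub_of_mem_Icc hV'm hV'I
  · simp only [hW, integral_const_sub_of_mem_Icc (hVm _) (hVI _)]
    rw [← hmean, integral_const_sub_of_mem_Icc hV'm hV'I]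
    simpa only [pow_one] using (hmom 1).const_sub Td
  · simp only [hW, variance_const_sub_of_mem_Icc (hVm _) (hVI _)]
    rw [← hvar, variance_const_sub_of_mem_Icc hV'm hV'I]
    have h1 : Tendsto (fun Tr => ∫ ω, V Tr ω ∂P) atTop (𝓝 (∫ y, V' y ∂pairsLaw r π)) := by
      simpa only [pow_one] using hmom 1
    exact (hmom 2).sub (h1.pow 2)
  · intro hstat Tr hTr
    have hρs : ∀ j, IsStationaryInit (r j) (ρ j) := fun j => by
      have hm := hM.measurable_init _ j.not_isDiag
      have := hstat j j.2.1
      rw [IsStationaryInit, hρ, map_measureReal_apply hm (measurableSet_singleton _)]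
      exact this
    have h1 := hVpow Tr 1
    simp only [pow_one] at h1
    rw [hW]
    refine ⟨memLp_const_sub_of_mem_Icc (hVm Tr) (hVI Tr), ?_, ?_⟩
    · rw [integral_const_sub_of_mem_Icc (hVm _) (hVI _), h1,
        integral_idleTime_stationary hr0 hρs hTd.le hTr, commMean_eq lamC lamI hx hr]
    · rw [variance_const_sub_of_mem_Icc (hVm _) (hVI _), h1, hVpow,
        integral_idleTime_stationary hr0 hρs hTd.le hTr,
        integral_idleTime_sq_stationary hr0 hρs hTd.le hTr, commVar_eq lamC lamI hx hr]
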